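/- For a probability measure $\mu$ on $\mathbb{R}$ let $\mu^{*n}$, $n\ge 0$, denote its convolution powers ($\mu^{*0}=\delta_0$), and let $\mathscr{C}$ be the set of probability measures $\mu$ on $\mathbb{R}$ with the following property: if $\mu_1$ is any probability measure on $\mathbb{R}$ such that $\mu^{*n}$ and $\mu_1^{*n}$ coincide on $[0,\infty)$ for all $n\ge 0$, then $\mu=\mu_1$. Call $\mu$ downward skip free if its support is included in $\mathbb{Z}$ and $\mu(\{n\})=0$ for all integers $n\le -2$. Theorem. Let $\mu$ be a downward skip free probability measure on $\mathbb{R}$ such that $\mu((0,\infty))>0$ or $\mu=\delta_0$. Then $\mu\in\mathscr{C}$. -/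

import Mathlib

open MeasureTheory

/-- The `n`-fold convolution power `μ^{*n}` of a measure on `ℝ`, with `μ^{*0} = δ₀`. -/
noncomputable def convPow (μ : Measure ℝ) : ℕ → Measure ℝ
  | 0 => Measure.dirac 0
  | n + 1 => Measure.conv (convPow μ n) μ

/-- The class `𝒞` of probability measures on `ℝ` that are determined, among all probability
measures on `ℝ`, by the restrictions to `[0, ∞)` of their convolution powers. -/
def classC : Set (Measure ℝ) :=
  {μ | IsProbabilityMeasure μ ∧
    ∀ μ₁ : Measure ℝ, IsProbabilityMeasure μ₁ →
      (∀ n : ℕ, (convPow μ n).restrict (Set.Ici 0) = (convPow μ₁ n).restrict (Set.Ici 0)) →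
      μ = μ₁}

/-- A measure on `ℝ` is downward skip free if its (topological) support is included in `ℤ` and
it gives no mass to the integers `n ≤ -2`. -/
def IsDownwardSkipFree (μ : Measure ℝ) : Prop :=
  μ.support ⊆ Set.range (fun n : ℤ => (n : ℝ)) ∧ ∀ n : ℤ, n ≤ -2 → μ {(n : ℝ)} = 0

/-!
Write `μ = ν + η` with `ν` on `[0, ∞)` and `η` on `(-∞, 0)`, and likewise `μ₁ = ν + η₁`: the first
convolution powers provide the common part `ν`. As `η ∗ η` and `η₁ ∗ η₁` do not charge `[0, ∞)`,
comparing the squares shows that `ν ∗ η = ν ∗ η₁` there. Suppose that `η` is concentrated at `-a`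
and that `ν` has an atom `K ≥ a` and no mass in `(K, K + a)`; in the skip free case, `a = 1` and `K`
is any positive atom. Since `ν ∗ η` does not charge `(K - a, K)`, the atom `K` forces `η₁` not to
charge `(-a, 0)`, so `η₁` lives on `(-∞, -a]`. Hence `ν ∗ η₁` gives `[K - a, ∞)` at most the mass
`ν [K, ∞) * η₁ univ`, which is what `ν ∗ η` gives it, and because of the atom `K` equality holds
only if `η₁` is concentrated at `-a`.
-/

open Set
open scoped Pointwise

section General

variable {M : Type*} [MeasurableSpace M]

lemma eq_smul_dirac_of_ae_eq {μ : Measure M} {a : M} (h : ∀ᵐ x ∂μ, x = a) :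
    μ = μ univ • Measure.dirac a := by
  rw [← Measure.map_const, ← Measure.map_congr (f := id) h, Measure.map_id]

variable [AddMonoid M] [MeasurableAdd₂ M]

lemma conv_apply (μ ν : Measure M) [SFinite ν] {s : Set M} (hs : MeasurableSet s) :
    (μ.conv ν) s = ∫⁻ x, ν ((x + ·) ⁻¹' s) ∂μ := by
  rw [Measure.conv, Measure.map_apply measurable_add hs,
    Measure.prod_apply (measurable_add hs)]
  rfl

lemma measure_mul_le_conv_add (μ ν : Measure M) [SFinite ν] (s t : Set M) :
    μ s * ν t ≤ (μ.conv ν) (s + t) := by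
  rw [← Measure.prod_prod, ← add_image_prod]
  exact Measure.le_map_apply_image measurable_add.aemeasurable _

lemma measure_eq_zero_of_conv_add_eq_zero {μ ν : Measure M} [SFinite ν] {s t : Set M}
    (hs : μ s ≠ 0) (h : (μ.conv ν) (s + t) = 0) : ν t = 0 := by
  have hmul : μ s * ν t = 0 := le_zero_iff.1 (h ▸ measure_mul_le_conv_add μ ν s t)
  exact (mul_eq_zero.1 hmul).resolve_left hs

end General

section LinearOrder

variable {X : Type*} [LinearOrder X] [TopologicalSpace X] [OrderClosedTopology X]
  [MeasurableSpace X] [OpensMeasurableSpace X]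

lemma restrict_Ici_add_restrict_Iio (μ : Measure X) (a : X) :
    μ.restrict (Ici a) + μ.restrict (Iio a) = μ := by
  rw [← compl_Ici, Measure.restrict_add_restrict_compl measurableSet_Ici]

lemma measure_Iio_eq_of_restrict_Ici_eq {μ μ₁ : Measure X} [IsFiniteMeasure μ] {a : X}
    (huniv : μ univ = μ₁ univ) (h : μ.restrict (Ici a) = μ₁.restrict (Ici a)) :
    μ (Iio a) = μ₁ (Iio a) := by
  have hIci : μ (Ici a) = μ₁ (Ici a) := by
    rw [← Measure.restrict_apply_self, h, Measure.restrict_apply_self]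
  rwa [← measure_add_measure_compl measurableSet_Ici, ← measure_add_measure_compl measurableSet_Ici,
    ← hIci, ENNReal.add_right_inj (measure_ne_top _ _), compl_Ici] at huniv

lemma measure_Ioi_lt_measure_Ici {μ : Measure X} [IsFiniteMeasure μ] {a : X} (ha : μ {a} ≠ 0) :
    μ (Ioi a) < μ (Ici a) := by
  rw [← Ioi_union_left, measure_union (by simp) (measurableSet_singleton a)]
  exact ENNReal.lt_add_right (measure_ne_top _ _) ha

end LinearOrder

section OrderedGroup

variable {G : Type*} [AddCommGroup G] [LinearOrder G] [IsOrderedAddMonoid G] [TopologicalSpace G]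
  [OrderClosedTopology G] [MeasurableSpace G] [OpensMeasurableSpace G] [MeasurableAdd₂ G]

lemma conv_apply_Ici_eq_zero {μ ν : Measure G} [SFinite ν]
    (hμ : ∀ᵐ x ∂μ, x < 0) (hν : ∀ᵐ y ∂ν, y < 0) : (μ.conv ν) (Ici 0) = 0 := by
  rw [conv_apply μ ν measurableSet_Ici]
  refine lintegral_eq_zero_of_ae_eq_zero ?_
  filter_upwards [hμ] with x hx
  refine measure_eq_zero_iff_ae_notMem.2 ?_
  filter_upwards [hν] with y hy
  exact (add_neg hx hy).not_ge

lemma conv_self_apply_of_subset_Ici (μ : Measure G) [SFinite μ] {s : Set G} (hs : s ⊆ Ici 0) :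
    (μ.conv μ) s = ((μ.restrict (Ici 0)).conv (μ.restrict (Ici 0))) s +
      2 * ((μ.restrict (Ici 0)).conv (μ.restrict (Iio 0))) s := by
  have hneg : ((μ.restrict (Iio 0)).conv (μ.restrict (Iio 0))) s = 0 :=
    measure_mono_null hs <| conv_apply_Ici_eq_zero (ae_restrict_mem measurableSet_Iio)
      (ae_restrict_mem measurableSet_Iio)
  conv_lhs => rw [← restrict_Ici_add_restrict_Iio μ 0]
  rw [Measure.conv_add, Measure.add_conv, Measure.add_conv,
    Measure.conv_comm (μ.restrict (Iio 0)) (μ.restrict (Ici 0))]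
  simp only [Measure.add_apply, hneg]
  ring

lemma restrict_conv_restrict_Iio_eq {μ μ₁ : Measure G} [IsFiniteMeasure μ] [SFinite μ₁]
    (h : μ.restrict (Ici 0) = μ₁.restrict (Ici 0))
    (hconv : (μ.conv μ).restrict (Ici 0) = (μ₁.conv μ₁).restrict (Ici 0)) :
    ((μ.restrict (Ici 0)).conv (μ.restrict (Iio 0))).restrict (Ici 0) =
      ((μ.restrict (Ici 0)).conv (μ₁.restrict (Iio 0))).restrict (Ici 0) := by
  ext s hs
  have hsquare := congrArg (· s) hconv
  simp only [Measure.restrict_apply hs] at hsquare ⊢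
  rwa [conv_self_apply_of_subset_Ici μ inter_subset_right,
    conv_self_apply_of_subset_Ici μ₁ inter_subset_right, ← h,
    ENNReal.add_right_inj (measure_ne_top _ _),
    ENNReal.mul_right_inj two_ne_zero ENNReal.ofNat_ne_top] at hsquare

lemma ae_eq_of_le_conv_Ici {μ ν : Measure G} [IsFiniteMeasure μ] [IsFiniteMeasure ν] {b K : G}
    (hK : μ {K} ≠ 0) (hb : ∀ᵐ y ∂ν, y ≤ b)
    (h : μ (Ici K) * ν univ ≤ (μ.conv ν) (Ici (K + b))) : ∀ᵐ y ∂ν, y = b := by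
  have hconv : (μ.conv ν) (Ici (K + b)) = ∫⁻ y, μ (Ici (K + b - y)) ∂ν := by
    rw [Measure.conv_comm, conv_apply ν μ measurableSet_Ici]
    simp only [preimage_const_add_Ici]
  have hle : ∀ᵐ y ∂ν, μ (Ici (K + b - y)) ≤ μ (Ici K) := by
    filter_upwards [hb] with y hy
    exact measure_mono <| Ici_subset_Ici.2 <| by
      rw [add_sub_assoc]; exact le_add_of_nonneg_right (sub_nonneg.2 hy)
  have heq : ∀ᵐ y ∂ν, μ (Ici (K + b - y)) = μ (Ici K) :=
    ae_eq_of_ae_le_of_lintegral_le hle (hconv ▸ measure_ne_top _ _) aemeasurable_const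
      (by rwa [lintegral_const, ← hconv])
  filter_upwards [hb, heq] with y hy heqy
  refine hy.antisymm (not_lt.1 fun hlt => ?_)
  have hsub : Ici (K + b - y) ⊆ Ioi K := Ici_subset_Ioi.2 <| by
    rw [add_sub_assoc]; exact lt_add_of_pos_right K (sub_pos.2 hlt)
  exact ((measure_mono hsub).trans_lt (measure_Ioi_lt_measure_Ici hK)).ne heqy

lemma eq_smul_dirac_of_restrict_conv_eq {ν η : Measure G} [IsFiniteMeasure ν] [IsFiniteMeasure η]
    {a K : G} (hη : ∀ᵐ y ∂η, y < 0) (haK : a ≤ K) (hK : ν {K} ≠ 0)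
    (hgap : ν (Ioo K (K + a)) = 0)
    (h : (ν.conv (η univ • Measure.dirac (-a))).restrict (Ici 0) =
      (ν.conv η).restrict (Ici 0)) :
    η = η univ • Measure.dirac (-a) := by
  have hshift : ∀ s ⊆ Ici 0, MeasurableSet s → (ν.conv η) s = η univ * ν ((· + -a) ⁻¹' s) := by
    intro s hs hsm
    rw [← Measure.restrict_eq_self _ hs, ← h, Measure.restrict_eq_self _ hs,
      Measure.conv_smul_right, Measure.conv_dirac, Measure.smul_apply,
      Measure.map_apply (measurable_add_const (-a)) hsm, smul_eq_mul]
  have haK_nonneg : 0 ≤ K + -a := le_add_neg_iff_le.2 haK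
  have hIoo : η (Ioo (-a) 0) = 0 := by
    refine measure_eq_zero_of_conv_add_eq_zero hK ?_
    rw [singleton_add, image_const_add_Ioo, add_zero,
      hshift _ (fun x hx => haK_nonneg.trans hx.1.le) measurableSet_Ioo, preimage_add_const_Ioo,
      add_sub_cancel_right, sub_neg_eq_add, hgap, mul_zero]
  have hle : ∀ᵐ y ∂η, y ≤ -a := by
    filter_upwards [hη, measure_eq_zero_iff_ae_notMem.1 hIoo] with y hy hya
    exact not_lt.1 fun hlt => hya ⟨hlt, hy⟩
  refine eq_smul_dirac_of_ae_eq (ae_eq_of_le_conv_Ici hK hle ?_)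
  rw [hshift _ (Ici_subset_Ici.2 haK_nonneg) measurableSet_Ici, preimage_add_const_Ici,
    add_sub_cancel_right, mul_comm]

theorem theorem8733_general {μ μ₁ : Measure G} [IsFiniteMeasure μ] {a : G}
    (hneg : ∀ᵐ x ∂μ, x < 0 → x = -a)
    (hatom : μ (Iio 0) ≠ 0 → ∃ K, a ≤ K ∧ μ {K} ≠ 0 ∧ μ (Ioo K (K + a)) = 0)
    (huniv : μ univ = μ₁ univ) (h : μ.restrict (Ici 0) = μ₁.restrict (Ici 0))
    (hconv : (μ.conv μ).restrict (Ici 0) = (μ₁.conv μ₁).restrict (Ici 0)) :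
    μ = μ₁ := by
  have : IsFiniteMeasure μ₁ := ⟨huniv ▸ measure_lt_top μ univ⟩
  have hmass : μ (Iio 0) = μ₁ (Iio 0) := measure_Iio_eq_of_restrict_Ici_eq huniv h
  suffices hIio : μ.restrict (Iio 0) = μ₁.restrict (Iio 0) by
    rw [← restrict_Ici_add_restrict_Iio μ 0, ← restrict_Ici_add_restrict_Iio μ₁ 0, h, hIio]
  by_cases hzero : μ (Iio 0) = 0
  · rw [Measure.restrict_eq_zero.2 hzero, Measure.restrict_eq_zero.2 (hmass ▸ hzero)]
  obtain ⟨K, haK, hK, hgap⟩ := hatom hzero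
  have hK_nonneg : 0 ≤ K := by
    obtain ⟨x, hx, hxa⟩ := ((frequently_ae_iff.2 hzero).and_eventually hneg).exists
    exact (neg_lt_zero.1 (hxa hx ▸ hx)).le.trans haK
  have hdirac : μ.restrict (Iio 0) = μ₁.restrict (Iio 0) univ • Measure.dirac (-a) := by
    rw [Measure.restrict_apply_univ, ← hmass, ← Measure.restrict_apply_univ]
    exact eq_smul_dirac_of_ae_eq ((ae_restrict_iff' measurableSet_Iio).2 hneg)
  rw [hdirac]
  refine (eq_smul_dirac_of_restrict_conv_eq (ν := μ.restrict (Ici 0)) (η := μ₁.restrict (Iio 0))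
    (ae_restrict_mem measurableSet_Iio) haK ?_ ?_ ?_).symm
  · rwa [Measure.restrict_eq_self _ (singleton_subset_iff.2 (mem_Ici.2 hK_nonneg))]
  · exact Measure.absolutelyContinuous_of_le Measure.restrict_le_self hgap
  · rw [← hdirac, restrict_conv_restrict_Iio_eq h hconv]

end OrderedGroup

namespace IsDownwardSkipFree

variable {μ : Measure ℝ}

lemma ae_exists_intCast_eq (hμ : IsDownwardSkipFree μ) : ∀ᵐ x ∂μ, ∃ k : ℤ, (k : ℝ) = x := by
  filter_upwards [Measure.support_mem_ae (μ := μ)] with x hx using hμ.1 hx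

lemma ae_eq_neg_one_of_neg (hμ : IsDownwardSkipFree μ) : ∀ᵐ x ∂μ, x < 0 → x = -1 := by
  have hskip : ∀ᵐ x ∂μ, ∀ k : ℤ, k ≤ -2 → x ≠ (k : ℝ) :=
    ae_all_iff.2 fun k => Filter.eventually_imp_distrib_left.2 fun hk =>
      measure_eq_zero_iff_ae_notMem.1 (hμ.2 k hk)
  filter_upwards [hμ.ae_exists_intCast_eq, hskip]
  rintro _ ⟨k, rfl⟩ hk hneg
  have hk_neg : k < 0 := Int.cast_lt_zero.1 hneg
  have hk_gt : ¬ k ≤ -2 := fun hle => hk k hle rfl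
  exact_mod_cast (show k = -1 by lia)

lemma measure_Ioo_intCast_eq_zero (hμ : IsDownwardSkipFree μ) (k : ℤ) :
    μ (Ioo (k : ℝ) (k + 1)) = 0 := by
  refine measure_eq_zero_iff_ae_notMem.2 ?_
  filter_upwards [hμ.ae_exists_intCast_eq]
  rintro _ ⟨j, rfl⟩ ⟨hkj, hjk⟩
  have hlt : k < j := Int.cast_lt.1 hkj
  have hlt_succ : j < k + 1 := by exact_mod_cast hjk
  lia

lemma exists_one_le_atom (hμ : IsDownwardSkipFree μ) (hpos : μ (Ioi 0) ≠ 0) :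
    ∃ K : ℝ, 1 ≤ K ∧ μ {K} ≠ 0 ∧ μ (Ioo K (K + 1)) = 0 := by
  suffices ∃ k : ℤ, 0 < k ∧ μ {(k : ℝ)} ≠ 0 by
    obtain ⟨k, hk_pos, hk⟩ := this
    exact ⟨k, by exact_mod_cast hk_pos, hk, hμ.measure_Ioo_intCast_eq_zero k⟩
  contrapose! hpos
  have hnull : ∀ᵐ x ∂μ, ∀ k : ℤ, 0 < k → x ≠ (k : ℝ) :=
    ae_all_iff.2 fun k => Filter.eventually_imp_distrib_left.2 fun hk =>
      measure_eq_zero_iff_ae_notMem.1 (hpos k hk)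
  refine measure_eq_zero_iff_ae_notMem.2 ?_
  filter_upwards [hμ.ae_exists_intCast_eq, hnull]
  rintro _ ⟨k, rfl⟩ hk hk_pos
  exact hk k (Int.cast_pos.1 (mem_Ioi.1 hk_pos)) rfl

end IsDownwardSkipFree

lemma convPow_one (μ : Measure ℝ) [SFinite μ] : convPow μ 1 = μ :=
  Measure.dirac_zero_conv μ

lemma convPow_two (μ : Measure ℝ) [SFinite μ] : convPow μ 2 = μ.conv μ := by
  rw [convPow, convPow_one]

theorem theorem8733 (μ : Measure ℝ) [IsProbabilityMeasure μ]
    (hμ : IsDownwardSkipFree μ)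
    (hpos : μ (Set.Ioi 0) ≠ 0 ∨ μ = Measure.dirac 0) :
    μ ∈ classC := by
  exact ⟨inferInstance, fun μ₁ _ hconv => theorem8733_general hμ.ae_eq_neg_one_of_neg
    (fun hneg => hpos.elim hμ.exists_one_le_atom fun hdirac => absurd (by simp [hdirac]) hneg)
    (by simp) (by simpa only [convPow_one] using hconv 1)
    (by simpa only [convPow_two] using hconv 2)⟩
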